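/- Let $(\mathbb{B}, \|\cdot\|)$ be a nonzero complex normed linear space. Then $\mathbb{B}$ is isometrically isomorphic (by a $\mathbb{C}$-linear map) to a complex inner product space if and only if any one of the following conditions holds; that is, each single condition is equivalent to it (and, in $(I_6)$, this is so for each fixed integer $n \geq 3$). - $(I_1)$ There exists a fixed constant $\gamma \in \mathbb{R} \setminus \{0, \pm 1\}$ such that whenever $f, g \in \mathbb{B}$ with $\|f + g\| = \|f - g\|$, we have $\|f + \gamma g\| = \|f - \gamma g\|$. - $(I'_1)$ There exists a fixed constant $\gamma' \in \mathbb{R} \setminus \{0, \pm 1\}$ such that whenever $f', g' \in \mathbb{B}$ with $\|f'\| = \|g'\|$, we have $\|f' + \gamma' g'\| = \|g' + \gamma' f'\|$. - $(I_2)$ For all $f, g, h \in \mathbb{B}$: if $f + g + h = 0$ and $\|f\| = \|g\|$, then $\|f - h\| = \|g - h\|$. - $(I_3)$ For all $f, g, h, k \in \mathbb{B}$: if $f + g + h + k = 0$, $\|f\| = \|g\|$ and $\|h\| = \|k\|$, then $\|f - h\| = \|g - k\|$ and $\|g - h\| = \|f - k\|$. - $(I_4)$ For all $f_1, f_2 \in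 \mathbb{B}$, the expression $$\phi(f_1, f_2; g) = \|f_1 + f_2 + g\|^2 + \|f_1 + f_2 - g\|^2 - \|f_1 - f_2 - g\|^2 - \|f_1 - f_2 + g\|^2$$ is independent of $g \in \mathbb{B}$. - $(I_5)$ If $f, g \in \mathbb{B}$ and $\|f\| = \|g\|$, then $\|\alpha f + \alpha^{-1} g\| \geq \|f + g\|$ for all $0 \neq \alpha \in \mathbb{R}$. - $(I_6)$ For a fixed integer $n \geq 3$, and all vectors $f_1, \ldots, f_n \in \mathbb{B}$, $$f_1 + \cdots + f_n = 0 \quad \Longrightarrow \quad \sum_{i < j} \|f_i - f_j\|^2 = n \sum_{i=1}^n \|f_i\|^2.$$ -/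

import Mathlib

universe u

section LorchConditions

variable (B : Type u) [NormedAddCommGroup B] [NormedSpace ℂ B]

/-- `B` is isometrically and complex-linearly isomorphic to a complex inner product space
(no completeness is required). -/
def IsometricToInnerProductSpace : Prop :=
  ∃ (H : Type u) (_ : NormedAddCommGroup H) (_ : InnerProductSpace ℂ H),
    Nonempty (B ≃ₗᵢ[ℂ] H)

/-- Condition `I₁`, with one fixed real constant `γ ≠ 0, 1, -1`. -/
def LorchI1 : Prop :=
  ∃ γ : ℝ, γ ≠ 0 ∧ γ ≠ 1 ∧ γ ≠ -1 ∧
    ∀ f g : B, ‖f + g‖ = ‖f - g‖ → ‖f + (γ : ℂ) • g‖ = ‖f - (γ : ℂ) • g‖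

/-- Condition `I'₁`, with one fixed real constant `γ' ≠ 0, 1, -1`. -/
def LorchI1' : Prop :=
  ∃ γ' : ℝ, γ' ≠ 0 ∧ γ' ≠ 1 ∧ γ' ≠ -1 ∧
    ∀ f g : B, ‖f‖ = ‖g‖ → ‖f + (γ' : ℂ) • g‖ = ‖g + (γ' : ℂ) • f‖

/-- Condition `I₂`. -/
def LorchI2 : Prop :=
  ∀ f g h : B, f + g + h = 0 → ‖f‖ = ‖g‖ → ‖f - h‖ = ‖g - h‖

/-- Condition `I₃`. -/
def LorchI3 : Prop :=
  ∀ f g h k : B, f + g + h + k = 0 → ‖f‖ = ‖g‖ → ‖h‖ = ‖k‖ →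
    ‖f - h‖ = ‖g - k‖ ∧ ‖g - h‖ = ‖f - k‖

variable {B} in
/-- The expression `φ(f₁, f₂; g)` of condition `I₄`. -/
def lorchPhi (f₁ f₂ g : B) : ℝ :=
  ‖f₁ + f₂ + g‖ ^ 2 + ‖f₁ + f₂ - g‖ ^ 2 - ‖f₁ - f₂ - g‖ ^ 2 - ‖f₁ - f₂ + g‖ ^ 2

/-- Condition `I₄`: `φ(f₁, f₂; g)` does not depend on `g`. -/
def LorchI4 : Prop :=
  ∀ f₁ f₂ g g' : B, lorchPhi f₁ f₂ g = lorchPhi f₁ f₂ g'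

/-- Condition `I₅`, for all nonzero real `α`. -/
def LorchI5 : Prop :=
  ∀ f g : B, ‖f‖ = ‖g‖ →
    ∀ α : ℝ, α ≠ 0 → ‖f + g‖ ≤ ‖(α : ℂ) • f + ((α⁻¹ : ℝ) : ℂ) • g‖

/-- Condition `I₆` for `n` vectors; the sum on the left runs over the pairs `i < j`. -/
def LorchI6 (n : ℕ) : Prop :=
  ∀ f : Fin n → B, ∑ i, f i = 0 →
    ∑ i, ∑ j ∈ Finset.Ioi i, ‖f i - f j‖ ^ 2 = (n : ℝ) * ∑ i, ‖f i‖ ^ 2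

end LorchConditions

/-! Conditions I₁, I'₁, I₂, I₃, I₅ all yield `IsoscelesImpliesBirkhoff`, a statement about real
lines only. It makes the nearest point of a line unique, so for `‖f‖ = ‖g‖` the reflection fixing `f
+ g` and negating `f - g` is an isometry of their span exchanging `f` and `g`. Hence, if `c • e` is
the point of `ℝ e` nearest to `x`, then `‖e‖ ^ 2 * c` is symmetric in `e` and `x`. It plays the role
of the inner product: `norm_add_sq` is the law of cosines, and adding it for `g` and `-g` gives the
parallelogram law.

I₄ contains the parallelogram law as a special case; I₆ reduces to three vectors, where a recursion
for the parallelogram defect forces it to vanish. The Jordan–von Neumann theorem then supplies the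
complex inner product. The converses are computations in a real inner product space. -/

section RealNormed

variable {E : Type*} [NormedAddCommGroup E] [NormedSpace ℝ E]

/-! ### Midpoints of chords have minimal norm -/

/-- Isosceles orthogonality implies Birkhoff orthogonality: the midpoint of a chord of a sphere has
minimal norm on the line carrying the chord. -/
def IsoscelesImpliesBirkhoff (E : Type*) [NormedAddCommGroup E] [NormedSpace ℝ E] : Prop :=
  ∀ f g : E, ‖f‖ = ‖g‖ → ∀ s : ℝ, ‖f + g‖ ≤ ‖f + g + s • (f - g)‖

theorem norm_add_smul_le_of_mem_Icc (x d : E) (s τ : ℝ) (h0 : 0 ≤ τ) (h1 : τ ≤ 1) :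
    ‖x + (τ * s) • d‖ ≤ (1 - τ) * ‖x‖ + τ * ‖x + s • d‖ := by
  have h : x + (τ * s) • d = (1 - τ) • x + τ • (x + s • d) := by module
  rw [h]
  refine (norm_add_le _ _).trans ?_
  rw [norm_smul, norm_smul, Real.norm_of_nonneg h0, Real.norm_of_nonneg (by linarith)]

theorem norm_le_of_norm_add_eq_norm_sub {x y : E} (h : ‖x + y‖ = ‖x - y‖) : ‖x‖ ≤ ‖x + y‖ := by
  have h2 : ‖(2 : ℝ) • x‖ ≤ ‖x + y‖ + ‖x - y‖ := by
    have : (2 : ℝ) • x = (x + y) + (x - y) := by module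
    rw [this]
    exact norm_add_le _ _
  rw [norm_smul, Real.norm_of_nonneg zero_le_two] at h2
  linarith

theorem norm_add_pow_smul_eq_norm_sub {γ : ℝ}
    (h : ∀ f g : E, ‖f + g‖ = ‖f - g‖ → ‖f + γ • g‖ = ‖f - γ • g‖) (f g : E)
    (hfg : ‖f + g‖ = ‖f - g‖) (n : ℕ) : ‖f + γ ^ n • g‖ = ‖f - γ ^ n • g‖ := by
  induction n with
  | zero => simpa using hfg
  | succ n ih =>
    have := h _ _ ih
    rwa [smul_smul, ← pow_succ'] at this

/-- Equal norms at `±γ ^ n` put the norm there above its value at the midpoint, at parameters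
tending to 0. By convexity, a smaller value at `s` would make the norm smaller at all parameters
between 0 and `s`. -/
theorem isoscelesImpliesBirkhoff_of_abs_lt_one {γ : ℝ} (h0 : γ ≠ 0) (h1 : |γ| < 1)
    (h : ∀ f g : E, ‖f + g‖ = ‖f - g‖ → ‖f + γ • g‖ = ‖f - γ • g‖) :
    IsoscelesImpliesBirkhoff E := by
  intro f g hfg s
  by_contra! hlt
  have hs : s ≠ 0 := by
    rintro rfl
    simp at hlt
  obtain ⟨n, hn⟩ := exists_pow_lt_of_lt_one (abs_pos.2 hs) h1
  have hx : ‖(f + g) + (f - g)‖ = ‖(f + g) - (f - g)‖ := by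
    have e1 : (f + g) + (f - g) = (2 : ℝ) • f := by module
    have e2 : (f + g) - (f - g) = (2 : ℝ) • g := by module
    rw [e1, e2, norm_smul, norm_smul, hfg]
  have key := norm_add_pow_smul_eq_norm_sub h _ _ hx n
  set t := γ ^ n with ht
  have ht0 : t ≠ 0 := pow_ne_zero _ h0
  rw [← abs_pow, ← ht] at hn
  have hle : ∀ t' : ℝ, |t'| = |t| → ‖f + g‖ ≤ ‖f + g + t' • (f - g)‖ := by
    intro t' ht'
    apply norm_le_of_norm_add_eq_norm_sub
    rcases abs_eq_abs.1 ht' with rfl | rfl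
    · exact key
    · rw [neg_smul, sub_neg_eq_add, ← sub_eq_add_neg, key]
  have hτ : |t| / |s| ≤ 1 := by
    rw [div_le_one (abs_pos.2 hs)]
    exact hn.le
  have hτ0 : 0 < |t| / |s| := div_pos (abs_pos.2 ht0) (abs_pos.2 hs)
  have a := norm_add_smul_le_of_mem_Icc (f + g) (f - g) s _ hτ0.le hτ
  have b := hle (|t| / |s| * s) (by
    rw [abs_mul, abs_div, abs_abs, abs_abs]
    field_simp)
  nlinarith

theorem isoscelesImpliesBirkhoff_of_homogeneous {γ : ℝ} (h0 : γ ≠ 0) (h1 : γ ≠ 1) (h1' : γ ≠ -1)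
    (h : ∀ f g : E, ‖f + g‖ = ‖f - g‖ → ‖f + γ • g‖ = ‖f - γ • g‖) :
    IsoscelesImpliesBirkhoff E := by
  rcases lt_trichotomy |γ| 1 with hγ | hγ | hγ
  · exact isoscelesImpliesBirkhoff_of_abs_lt_one h0 hγ h
  · rcases (abs_eq zero_le_one).1 hγ with h | h <;> contradiction
  · refine isoscelesImpliesBirkhoff_of_abs_lt_one (inv_ne_zero h0)
      (by rw [abs_inv]; exact inv_lt_one_of_one_lt₀ hγ) fun f g hfg => ?_
    -- Exchanging `f` and `g` replaces `γ` by `γ⁻¹`.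
    have := h g f (by rw [add_comm, hfg, norm_sub_rev])
    have e1 : f + γ⁻¹ • g = γ⁻¹ • (g + γ • f) := by
      rw [smul_add, smul_smul, inv_mul_cancel₀ h0, one_smul, add_comm]
    have e2 : f - γ⁻¹ • g = (-γ⁻¹) • (g - γ • f) := by
      rw [smul_sub, smul_smul, neg_mul, inv_mul_cancel₀ h0]
      module
    rw [e1, e2, norm_smul, norm_smul, norm_neg, this]

/-- Near the midpoint the hypothesis allows only a second-order drop of the norm, whereas by
convexity a smaller value at `s` would force a first-order drop. -/
theorem isoscelesImpliesBirkhoff_of_le_norm_smul_add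
    (h : ∀ f g : E, ‖f‖ = ‖g‖ → ∀ α : ℝ, α ≠ 0 → ‖f + g‖ ≤ ‖α • f + α⁻¹ • g‖) :
    IsoscelesImpliesBirkhoff E := by
  intro f g hfg s
  by_contra! hlt
  have quad : ∀ σ : ℝ, |σ| < 1 → (1 - σ ^ 2) * ‖f + g‖ ≤ ‖f + g + σ • (f - g)‖ := by
    intro σ hσ
    obtain ⟨hσ1, hσ2⟩ := abs_lt.1 hσ
    have hp : 0 < 1 + σ := by linarith
    have hm : 0 < 1 - σ := by linarith
    have hsp := Real.sqrt_pos.2 hp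
    have hsm := Real.sqrt_pos.2 hm
    have hsp2 := Real.mul_self_sqrt hp.le
    have hsm2 := Real.mul_self_sqrt hm.le
    set a := √(1 + σ)
    set b := √(1 - σ)
    -- The vector is `(1 + σ) • f + (1 - σ) • g`; dividing by the geometric mean of the coefficients
    -- makes them mutually inverse.
    have e : f + g + σ • (f - g) = (a * b) • ((a / b) • f + (a / b)⁻¹ • g) := by
      have e1 : a * b * (a / b) = 1 + σ := by rw [← hsp2]; field_simp
      have e2 : a * b * (a / b)⁻¹ = 1 - σ := by rw [← hsm2]; field_simp
      rw [smul_add, smul_smul, smul_smul, e1, e2]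
      module
    have hab : 1 - σ ^ 2 ≤ a * b := by
      have : (a * b) * (a * b) = 1 - σ ^ 2 := by
        calc (a * b) * (a * b) = (a * a) * (b * b) := by ring
          _ = _ := by rw [hsp2, hsm2]; ring
      have hab0 : 0 < a * b := by positivity
      nlinarith [sq_nonneg σ]
    rw [e, norm_smul, Real.norm_of_nonneg (by positivity : 0 ≤ a * b)]
    exact mul_le_mul hab (h f g hfg _ (by positivity)) (norm_nonneg _) (by positivity)
  have hs : s ≠ 0 := by
    rintro rfl
    simp at hlt
  set N := ‖f + g‖
  set δ := N - ‖f + g + s • (f - g)‖ with hδ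
  have hδ0 : 0 < δ := by simp only [hδ]; linarith
  have hN : 0 < N := (norm_nonneg _).trans_lt hlt
  set τ := min (min 1 (1 / (2 * |s|))) (δ / (2 * (s ^ 2 * N))) with hτ
  have hs2 : 0 < s ^ 2 := by positivity
  have habs := abs_pos.2 hs
  have hτ0 : 0 < τ := by simp only [hτ]; positivity
  have hτ1 : τ ≤ 1 := (min_le_left _ _).trans (min_le_left _ _)
  have hτ2 : τ ≤ 1 / (2 * |s|) := (min_le_left _ _).trans (min_le_right _ _)
  have hτ3 : τ ≤ δ / (2 * (s ^ 2 * N)) := min_le_right _ _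
  rw [le_div_iff₀ (by positivity)] at hτ2 hτ3
  have a := norm_add_smul_le_of_mem_Icc (f + g) (f - g) s τ hτ0.le hτ1
  have b := quad (τ * s) (by rw [abs_mul, abs_of_pos hτ0]; linarith)
  have c : (1 - (τ * s) ^ 2) * N ≤ N - τ * δ := by
    refine (b.trans a).trans (le_of_eq ?_)
    simp only [hδ]; ring
  have d : τ * δ ≤ τ * (τ * (s ^ 2 * N)) := by nlinarith
  have d' := le_of_mul_le_mul_left d hτ0
  nlinarith

/-! ### Strictness of the minimum -/

/-- If the chord from `g` to `f` does not lie on the sphere, its midpoint is the only point of least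
norm on the line carrying it. -/
theorem IsoscelesImpliesBirkhoff.lt_of_pos (h : IsoscelesImpliesBirkhoff E) {f g : E}
    (hfg : ‖f‖ = ‖g‖) (hlt : ‖f + g‖ < 2 * ‖f‖) {s : ℝ} (hs : 0 < s) :
    ‖f + g‖ < ‖f + g + s • (f - g)‖ := by
  refine lt_of_le_of_ne (h f g hfg s) fun heq => ?_
  set r := ‖f‖ with hr
  have hr0 : 0 < r := by have := norm_nonneg (f + g); linarith
  have hx : 0 < ‖f + g‖ := by
    refine (norm_nonneg _).lt_of_ne fun h0 => ?_
    rw [← h0] at heq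
    have hx0 := norm_eq_zero.1 h0.symm
    have hd := norm_eq_zero.1 heq.symm
    rw [hx0, zero_add, smul_eq_zero, or_iff_right hs.ne'] at hd
    have h2f : f = (1 / 2 : ℝ) • ((f + g) + (f - g)) := by module
    rw [hx0, hd, add_zero, smul_zero] at h2f
    rw [hr, h2f, norm_zero] at hr0
    exact hr0.false
  -- Push `g` in the direction `f + g` and rescale to norm `r`, giving `g'`. In the coordinates `f +
  -- g`, `f - g`, the first coordinate of `g'` is `α / 2 > 1 / 2`, so it decreases from `g'` to `f`.
  set ν := ‖g + (s / 2) • (f + g)‖ with hν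
  have hνle : ν ≤ r + s / 2 * ‖f + g‖ := by
    refine (norm_add_le _ _).trans (le_of_eq ?_)
    rw [norm_smul, Real.norm_of_nonneg (by positivity), ← hfg]
  have hνlt : ν < r * (1 + s) := by nlinarith
  have hscale : ∀ a b : ℝ, 0 < a → a * ‖f + g‖ ≤ ‖a • (f + g) + b • (f - g)‖ := by
    intro a b ha
    have e : a • (f + g) + b • (f - g) = a • (f + g + (b / a) • (f - g)) := by
      rw [smul_add a (f + g), smul_smul, mul_div_cancel₀ _ ha.ne']
    rw [e, norm_smul, Real.norm_of_nonneg ha.le]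
    exact mul_le_mul_of_nonneg_left (h f g hfg _) ha.le
  have hν0 : 0 < ν := by
    have e : g + (s / 2) • (f + g) = ((1 + s) / 2) • (f + g) + (-1 / 2 : ℝ) • (f - g) := by module
    rw [hν, e]
    exact lt_of_lt_of_le (by positivity) (hscale _ _ (by positivity))
  set β := r / ν with hβ
  have hβ0 : 0 < β := by positivity
  set α := β * (1 + s) with hα
  have hα1 : 1 < α := by
    rw [hα, hβ, div_mul_eq_mul_div, one_lt_div hν0]
    exact hνlt
  have hβs : 1 - β < s := by nlinarith
  have hg' : ‖f‖ = ‖β • (g + (s / 2) • (f + g))‖ := by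
    rw [norm_smul, Real.norm_of_nonneg hβ0.le, ← hν, hβ, div_mul_cancel₀ _ hν0.ne']
  set D := 1 + β + s * (α - 1) with hD
  have hD0 : 0 < D := by nlinarith
  -- `τ` solves for the point `f + g' + τ • (f - g')` on the ray through `f + g + s • (f - g)`. By
  -- `heq` its norm is `a / 2 * ‖f + g‖`, with `a < 1 + α`, too small for the minimality of `f +
  -- g'`.
  set τ := (s * (1 + α) + β - 1) / D with hτ
  have hτ0 : 0 < τ := div_pos (by nlinarith) hD0
  have hτD : τ * D = s * (1 + α) + β - 1 := div_mul_cancel₀ _ hD0.ne'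
  set a := 1 + α + τ * (1 - α) with ha
  have haD : a * D = 2 * (α + β) := by
    calc a * D = (1 + α) * D + (1 - α) * (τ * D) := by rw [ha]; ring
      _ = _ := by rw [hτD, hD]; ring
  have ha0 : 0 < a := by
    by_contra! hneg
    nlinarith
  have hb : 1 - β + τ * (1 + β) = s * a := by
    have : τ * (1 + β) = τ * D - τ * (s * (α - 1)) := by rw [hD]; ring
    rw [this, hτD, ha]; ring
  have key := h f _ hg' τ
  have e1 : f + β • (g + (s / 2) • (f + g))
      = ((1 + α) / 2) • (f + g) + ((1 - β) / 2) • (f - g) := by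
    rw [hα]; module
  have e2 : f + β • (g + (s / 2) • (f + g)) + τ • (f - β • (g + (s / 2) • (f + g)))
      = (a / 2) • (f + g) + ((1 - β + τ * (1 + β)) / 2) • (f - g) := by
    rw [ha, hα]; module
  have e3 : (a / 2) • (f + g) + ((1 - β + τ * (1 + β)) / 2) • (f - g)
      = (a / 2) • (f + g + s • (f - g)) := by
    rw [hb]; module
  rw [e2, e3, e1, norm_smul, ← heq, Real.norm_of_nonneg (by positivity)] at key
  have := (hscale ((1 + α) / 2) ((1 - β) / 2) (by linarith)).trans key
  have := le_of_mul_le_mul_right this hx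
  nlinarith

theorem IsoscelesImpliesBirkhoff.lt_of_ne (h : IsoscelesImpliesBirkhoff E) {f g : E}
    (hfg : ‖f‖ = ‖g‖) (hlt : ‖f + g‖ < 2 * ‖f‖) {s : ℝ} (hs : s ≠ 0) :
    ‖f + g‖ < ‖f + g + s • (f - g)‖ := by
  rcases hs.lt_or_gt with hs | hs
  · have := h.lt_of_pos hfg.symm (by rwa [add_comm, ← hfg]) (neg_pos.2 hs)
    rwa [neg_smul, ← smul_neg, neg_sub, add_comm g f] at this
  · exact h.lt_of_pos hfg hlt hs

/-! ### Nearest points on lines -/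

theorem exists_lt_norm_sub_smul_eq {e x : E} (he : e ≠ 0) {c M : ℝ} (hM : ‖x - c • e‖ ≤ M) :
    ∃ t ≤ c, ‖x - t • e‖ = M := by
  have he' := norm_pos_iff.2 he
  set K := (M + ‖x - c • e‖) / ‖e‖ with hK
  have hM0 : 0 ≤ M := (norm_nonneg _).trans hM
  have hK0 : 0 ≤ K := by positivity
  have hcont : ContinuousOn (fun t : ℝ => ‖x - t • e‖) (Set.Icc (c - K) c) := by fun_prop
  have hbig : M ≤ ‖x - (c - K) • e‖ := by
    have e1 : K • e = (x - (c - K) • e) - (x - c • e) := by module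
    have := norm_sub_le (x - (c - K) • e) (x - c • e)
    rw [← e1, norm_smul, Real.norm_of_nonneg hK0, hK, div_mul_cancel₀ _ he'.ne'] at this
    linarith
  obtain ⟨t, ht, hte⟩ := intermediate_value_Icc' (by linarith) hcont ⟨hM, hbig⟩
  exact ⟨t, ht.2, hte⟩

/-- `c • e` is a point of the line `ℝ e` nearest to `x`. -/
def IsNearestCoeff (e x : E) (c : ℝ) : Prop :=
  ∀ s : ℝ, ‖x - c • e‖ ≤ ‖x - s • e‖

theorem exists_isNearestCoeff {e : E} (he : e ≠ 0) (x : E) : ∃ c, IsNearestCoeff e x c := by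
  have he' := norm_pos_iff.2 he
  have hcont : Continuous fun t : ℝ => ‖x - t • e‖ := by fun_prop
  have hlow : ∀ t : ℝ, |t| * ‖e‖ - ‖x‖ ≤ ‖x - t • e‖ := by
    intro t
    have := norm_sub_norm_le (t • e) x
    rwa [norm_smul, Real.norm_eq_abs, norm_sub_rev] at this
  apply hcont.exists_forall_le
  refine Filter.tendsto_atTop_mono hlow ?_
  refine Filter.tendsto_atTop_add_const_right _ _ ?_
  exact (tendsto_norm_cocompact_atTop (E := ℝ)).atTop_mul_const he'

theorem IsoscelesImpliesBirkhoff.isNearestCoeff_midpoint (h : IsoscelesImpliesBirkhoff E)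
    {e x : E} {a b : ℝ} (hne : a ≠ b) (hab : ‖x - a • e‖ = ‖x - b • e‖) :
    IsNearestCoeff e x ((a + b) / 2) := by
  intro s
  have hne' := sub_ne_zero.2 hne
  have := h _ _ hab ((2 * s - a - b) / (a - b))
  have e1 : x - a • e + (x - b • e) = (2 : ℝ) • (x - ((a + b) / 2) • e) := by module
  have e2 : x - a • e + (x - b • e)
      + ((2 * s - a - b) / (a - b)) • (x - a • e - (x - b • e)) = (2 : ℝ) • (x - s • e) := by
    have : x - a • e - (x - b • e) = (-(a - b)) • e := by module
    rw [this, smul_smul, mul_neg, div_mul_cancel₀ _ hne']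
    module
  rw [e2, e1, norm_smul, norm_smul] at this
  simpa using this

/-- Choose `S` and `T` on either side of `c` at one common distance exceeding the minimum. The chord
they define leaves the sphere, so strictness makes its midpoint the only minimiser. -/
theorem IsoscelesImpliesBirkhoff.isNearestCoeff_unique (h : IsoscelesImpliesBirkhoff E)
    {e x : E} (he : e ≠ 0) {c c' : ℝ} (hc : IsNearestCoeff e x c) (hc' : IsNearestCoeff e x c') :
    c = c' := by
  obtain ⟨S, hSc, hS⟩ : ∃ S, c ≤ S ∧ ‖x - c • e‖ < ‖x - S • e‖ := by
    obtain ⟨t, ht, htM⟩ := exists_lt_norm_sub_smul_eq (e := -e) (x := x) (neg_ne_zero.2 he)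
      (c := -c) (M := ‖x - c • e‖ + 1) (by rw [neg_smul_neg]; linarith)
    refine ⟨-t, by linarith, ?_⟩
    rw [smul_neg, ← neg_smul] at htM
    linarith
  obtain ⟨T, hTc, hT⟩ := exists_lt_norm_sub_smul_eq he hS.le
  have hne : S ≠ T := by
    rintro rfl
    rw [le_antisymm hTc hSc] at hS
    exact hS.false
  have hne' := sub_ne_zero.2 hne
  have hmid := h.isNearestCoeff_midpoint hne hT.symm
  have e1 : x - S • e + (x - T • e) = (2 : ℝ) • (x - ((S + T) / 2) • e) := by module
  have hlt : ‖x - S • e + (x - T • e)‖ < 2 * ‖x - S • e‖ := by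
    rw [e1, norm_smul, Real.norm_of_nonneg zero_le_two]
    linarith [hmid c]
  have uniq : ∀ d, IsNearestCoeff e x d → d = (S + T) / 2 := by
    intro d hd
    by_contra hdne
    have hs : (2 * d - S - T) / (S - T) ≠ 0 := by
      refine div_ne_zero (fun h0 => hdne ?_) hne'
      linarith
    have := h.lt_of_ne hT.symm hlt hs
    have e2 : x - S • e + (x - T • e)
        + ((2 * d - S - T) / (S - T)) • (x - S • e - (x - T • e)) = (2 : ℝ) • (x - d • e) := by
      have : x - S • e - (x - T • e) = (-(S - T)) • e := by module
      rw [this, smul_smul, mul_neg, div_mul_cancel₀ _ hne']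
      module
    rw [e2, e1, norm_smul, norm_smul, Real.norm_of_nonneg zero_le_two] at this
    linarith [hd ((S + T) / 2)]
  rw [uniq c hc, uniq c' hc']

theorem IsoscelesImpliesBirkhoff.norm_sub_eq_norm_add (h : IsoscelesImpliesBirkhoff E)
    {e x : E} (hx : IsNearestCoeff e x 0) {t : ℝ} (ht : 0 < t) :
    ‖x - t • e‖ = ‖x + t • e‖ := by
  rcases eq_or_ne e 0 with rfl | he
  · simp
  obtain ⟨T, hT0, hT⟩ := exists_lt_norm_sub_smul_eq he (hx t)
  have hne : t ≠ T := by linarith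
  have := h.isNearestCoeff_unique he hx (h.isNearestCoeff_midpoint hne hT.symm)
  have hTt : T = -t := by linarith
  rw [← hT, hTt, neg_smul, sub_neg_eq_add]

/-- Any two vectors of equal norm in a plane are exchanged by a linear isometry of that plane. -/
theorem IsoscelesImpliesBirkhoff.norm_sub_smul_comm (h : IsoscelesImpliesBirkhoff E) {f g : E}
    (hfg : ‖f‖ = ‖g‖) (s : ℝ) : ‖f - s • g‖ = ‖g - s • f‖ := by
  have hx : IsNearestCoeff (f - g) (f + g) 0 := by
    intro t
    have := h f g hfg (-t)
    rw [neg_smul, ← sub_eq_add_neg] at this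
    rwa [zero_smul, sub_zero]
  have hsymm : ∀ t : ℝ, ‖(f + g) - t • (f - g)‖ = ‖(f + g) + t • (f - g)‖ := by
    intro t
    rcases lt_trichotomy t 0 with ht | rfl | ht
    · have := h.norm_sub_eq_norm_add hx (neg_pos.2 ht)
      rw [neg_smul, sub_neg_eq_add, ← sub_eq_add_neg] at this
      exact this.symm
    · simp
    · exact h.norm_sub_eq_norm_add hx ht
  rcases eq_or_ne s 1 with rfl | hs
  · rw [one_smul, one_smul, norm_sub_rev]
  have hs' := sub_ne_zero.2 hs.symm
  have e1 : f - s • g = ((1 - s) / 2) • ((f + g) + ((1 + s) / (1 - s)) • (f - g)) := by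
    rw [smul_add _ (f + g), smul_smul, div_mul_div_comm, mul_comm 2, mul_div_mul_left _ _ hs']
    module
  have e2 : g - s • f = ((1 - s) / 2) • ((f + g) - ((1 + s) / (1 - s)) • (f - g)) := by
    rw [smul_sub _ (f + g), smul_smul, div_mul_div_comm, mul_comm 2, mul_div_mul_left _ _ hs']
    module
  rw [e1, e2, norm_smul, norm_smul, hsymm]

/-! ### The nearest coefficient as an inner product -/

theorem IsNearestCoeff.neg {e x : E} {c : ℝ} (h : IsNearestCoeff e x c) :
    IsNearestCoeff e (-x) (-c) := by
  intro s
  have e1 : ∀ t : ℝ, ‖-x - t • e‖ = ‖x - (-t) • e‖ := fun t => by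
    rw [← norm_neg]; congr 1; module
  rw [e1, e1, neg_neg]
  exact h _

theorem IsNearestCoeff.add_left {e x : E} {c : ℝ} (h : IsNearestCoeff e x c) :
    IsNearestCoeff e (e + x) (1 + c) := by
  intro s
  have e1 : e + x - (1 + c) • e = x - c • e := by module
  have e2 : e + x - s • e = x - (s - 1) • e := by module
  rw [e1, e2]
  exact h _

theorem IsNearestCoeff.smul_right {e x : E} {c : ℝ} (h : IsNearestCoeff e x c) {b : ℝ}
    (hb : b ≠ 0) : IsNearestCoeff e (b • x) (b * c) := by
  intro s
  have e1 : b • x - (b * c) • e = b • (x - c • e) := by module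
  have e2 : b • x - s • e = b • (x - (s / b) • e) := by
    rw [smul_sub, smul_smul, mul_div_cancel₀ _ hb]
  rw [e1, e2, norm_smul, norm_smul]
  exact mul_le_mul_of_nonneg_left (h _) (norm_nonneg _)

theorem IsNearestCoeff.smul_left {e x : E} {c : ℝ} (h : IsNearestCoeff e x c) {b : ℝ}
    (hb : b ≠ 0) : IsNearestCoeff (b • e) x (c / b) := by
  intro s
  rw [smul_smul, smul_smul, div_mul_cancel₀ _ hb]
  exact h _

/-- Normalise both vectors, then exchange them by `norm_sub_smul_comm`. -/
theorem IsoscelesImpliesBirkhoff.isNearestCoeff_comm (h : IsoscelesImpliesBirkhoff E) {e x : E}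
    (he : e ≠ 0) (hx : x ≠ 0) {c : ℝ} (hc : IsNearestCoeff e x c) :
    IsNearestCoeff x e (‖e‖ ^ 2 * c / ‖x‖ ^ 2) := by
  have he' := norm_pos_iff.2 he
  have hx' := norm_pos_iff.2 hx
  have h1 := (hc.smul_left (inv_ne_zero he'.ne')).smul_right (inv_ne_zero hx'.ne')
  have hn : ‖‖e‖⁻¹ • e‖ = ‖‖x‖⁻¹ • x‖ := by
    rw [norm_smul, norm_smul, norm_inv, norm_inv, norm_norm, norm_norm,
      inv_mul_cancel₀ he'.ne', inv_mul_cancel₀ hx'.ne']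
  have h2 : IsNearestCoeff (‖x‖⁻¹ • x) (‖e‖⁻¹ • e) (‖x‖⁻¹ * (c / ‖e‖⁻¹)) := by
    intro s
    rw [h.norm_sub_smul_comm hn, h.norm_sub_smul_comm hn]
    exact h1 s
  have h3 := (h2.smul_left hx'.ne').smul_right he'.ne'
  rw [smul_inv_smul₀ hx'.ne', smul_inv_smul₀ he'.ne'] at h3
  convert h3 using 1
  field_simp

/-- The coefficient of `f` along `f + g` is computed twice, by symmetry and as 1 minus that of `g`;
uniqueness equates the results. -/
theorem IsoscelesImpliesBirkhoff.norm_add_sq (h : IsoscelesImpliesBirkhoff E) {f g : E}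
    (hf : f ≠ 0) (hg : g ≠ 0) (hs : f + g ≠ 0) {c : ℝ} (hc : IsNearestCoeff f g c) :
    ‖f + g‖ ^ 2 = ‖f‖ ^ 2 + ‖g‖ ^ 2 + 2 * (‖f‖ ^ 2 * c) := by
  have hN : ‖f + g‖ ^ 2 ≠ 0 := pow_ne_zero _ (norm_ne_zero_iff.2 hs)
  have hG : ‖g‖ ^ 2 ≠ 0 := pow_ne_zero _ (norm_ne_zero_iff.2 hg)
  have hcf := h.isNearestCoeff_comm hf hs hc.add_left
  have hc' := (h.isNearestCoeff_comm hf hg hc).add_left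
  rw [add_comm g f] at hc'
  have hcg := h.isNearestCoeff_comm hg hs hc'
  have hcf' := hcg.neg.add_left
  rw [show f + g + -g = f by abel] at hcf'
  have := h.isNearestCoeff_unique hs hcf hcf'
  field_simp at this
  linarith

theorem IsoscelesImpliesBirkhoff.innerProductSpaceable (h : IsoscelesImpliesBirkhoff E) :
    InnerProductSpaceable E := by
  refine ⟨fun f g => ?_⟩
  simp only [← sq]
  have two : ∀ x : E, ‖x + x‖ ^ 2 = 4 * ‖x‖ ^ 2 := fun x => by
    rw [← two_smul ℝ x, norm_smul, Real.norm_of_nonneg zero_le_two]; ring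
  rcases eq_or_ne f 0 with rfl | hf
  · simp; ring
  rcases eq_or_ne g 0 with rfl | hg
  · simp; ring
  rcases eq_or_ne (f + g) 0 with hp | hp
  · obtain rfl := eq_neg_of_add_eq_zero_right hp
    simp [two]; ring
  rcases eq_or_ne (f - g) 0 with hm | hm
  · obtain rfl := sub_eq_zero.1 hm
    simp [two]; ring
  obtain ⟨c, hc⟩ := exists_isNearestCoeff hf g
  have h1 := h.norm_add_sq hf hg hp hc
  have h2 := h.norm_add_sq hf (neg_ne_zero.2 hg) (by rwa [← sub_eq_add_neg]) hc.neg
  rw [← sub_eq_add_neg, norm_neg] at h2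
  linarith

end RealNormed

/-! ### Sums over pairs and the three-vector identity -/

theorem sum_sum_Ioi_eq_half {n : ℕ} (F : Fin n → Fin n → ℝ) (hs : ∀ i j, F i j = F j i)
    (h0 : ∀ i, F i i = 0) :
    2 * ∑ i, ∑ j ∈ Finset.Ioi i, F i j = ∑ i, ∑ j, F i j := by
  have hswap : ∑ i, ∑ j ∈ Finset.Iio i, F i j = ∑ i, ∑ j ∈ Finset.Ioi i, F i j := by
    rw [Finset.sum_comm' (t' := Finset.univ) (s' := fun j => Finset.Ioi j) (by simp)]
    exact Finset.sum_congr rfl fun i _ => Finset.sum_congr rfl fun j _ => hs _ _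
  have hsplit : ∀ i, ∑ j, F i j = ∑ j ∈ Finset.Iio i, F i j + ∑ j ∈ Finset.Ioi i, F i j := by
    intro i
    have hu : (Finset.univ : Finset (Fin n)) = insert i (Finset.Iio i ∪ Finset.Ioi i) := by
      ext j
      have := lt_trichotomy j i
      simp only [Finset.mem_univ, Finset.mem_insert, Finset.mem_union, Finset.mem_Iio,
        Finset.mem_Ioi, true_iff]
      tauto
    have hd : Disjoint (Finset.Iio i) (Finset.Ioi i) := by
      rw [Finset.disjoint_left]
      intro j hj hj'
      simp only [Finset.mem_Iio, Finset.mem_Ioi] at hj hj'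
      exact lt_asymm hj hj'
    rw [hu, Finset.sum_insert (by simp), h0, zero_add, Finset.sum_union hd]
  simp only [hsplit, Finset.sum_add_distrib, hswap]
  ring

section RealNormed

variable {E : Type*} [NormedAddCommGroup E] [NormedSpace ℝ E]

/-- The failure of the parallelogram law at `x`, `y`. -/
def parallelogramDefect (x y : E) : ℝ :=
  ‖x + y‖ ^ 2 + ‖x - y‖ ^ 2 - 2 * ‖x‖ ^ 2 - 2 * ‖y‖ ^ 2

theorem neg_le_parallelogramDefect (x y : E) : -(2 * ‖x‖ ^ 2) ≤ parallelogramDefect x y := by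
  have h : 2 * ‖y‖ ≤ ‖x + y‖ + ‖x - y‖ := by
    have h2 := norm_sub_le (x + y) (x - y)
    rwa [show x + y - (x - y) = (2 : ℝ) • y by module, norm_smul,
      Real.norm_of_nonneg zero_le_two] at h2
  have := norm_nonneg y
  unfold parallelogramDefect
  nlinarith [sq_nonneg (‖x + y‖ - ‖x - y‖)]

theorem norm_two_smul_sq (x : E) : ‖(2 : ℝ) • x‖ ^ 2 = 4 * ‖x‖ ^ 2 := by
  rw [norm_smul, Real.norm_of_nonneg zero_le_two]; ring

theorem parallelogramDefect_two_smul (x y : E) :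
    parallelogramDefect ((2 : ℝ) • x) ((2 : ℝ) • y) = 4 * parallelogramDefect x y := by
  unfold parallelogramDefect
  rw [← smul_add, ← smul_sub]
  simp only [norm_two_smul_sq]
  ring

/-- Along `y, 2y, 4y, …` the defect satisfies `u (k+2) = 2 * u (k+1) - 4 * u k`, so `u (k+3) = -8 *
u k`. A negative value would be multiplied by powers of 64, against the lower bound `-(2 * ‖x‖ ^
2)`, which does not depend on `y`. Thus the defect is nonnegative, and the factor `-8` makes it
zero. -/
theorem innerProductSpaceable_of_three_vectors
    (h : ∀ a b c : E, a + b + c = 0 →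
      ‖a - b‖ ^ 2 + ‖a - c‖ ^ 2 + ‖b - c‖ ^ 2 = 3 * (‖a‖ ^ 2 + ‖b‖ ^ 2 + ‖c‖ ^ 2)) :
    InnerProductSpaceable E := by
  have hrec : ∀ x y : E, parallelogramDefect ((2 : ℝ) • x) y + parallelogramDefect x ((2 : ℝ) • y)
      = 2 * parallelogramDefect x y := by
    intro x y
    have h1 := h x y (-(x + y)) (by abel)
    have h2 := h x (-y) (-(x - y)) (by abel)
    rw [show x - -(x + y) = (2 : ℝ) • x + y by module,
      show y - -(x + y) = x + (2 : ℝ) • y by module, norm_neg] at h1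
    rw [show x - -y = x + y by abel, show x - -(x - y) = (2 : ℝ) • x - y by module,
      show -y - -(x - y) = x - (2 : ℝ) • y by module, norm_neg, norm_neg] at h2
    unfold parallelogramDefect
    rw [norm_two_smul_sq, norm_two_smul_sq]
    linarith
  have h8 : ∀ x y : E, parallelogramDefect x ((2 : ℝ) • (2 : ℝ) • (2 : ℝ) • y)
      = -8 * parallelogramDefect x y := by
    intro x y
    have h1 := hrec x ((2 : ℝ) • y)
    have h2 := hrec x ((2 : ℝ) • (2 : ℝ) • y)
    rw [parallelogramDefect_two_smul] at h1 h2
    linarith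
  have hpow : ∀ (n : ℕ) (x y : E), ∃ z, parallelogramDefect x z
      = (-8) ^ n * parallelogramDefect x y := by
    intro n x y
    induction n with
    | zero => exact ⟨y, by simp⟩
    | succ n ih =>
      obtain ⟨z, hz⟩ := ih
      exact ⟨_, (h8 x z).trans (by rw [hz]; ring)⟩
  have hnonneg : ∀ x y : E, 0 ≤ parallelogramDefect x y := by
    intro x y
    by_contra! hneg
    obtain ⟨n, hn⟩ := pow_unbounded_of_one_lt (2 * ‖x‖ ^ 2 / -parallelogramDefect x y)
      (by norm_num : (1 : ℝ) < 64)
    rw [div_lt_iff₀ (by linarith)] at hn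
    obtain ⟨z, hz⟩ := hpow (2 * n) x y
    have := neg_le_parallelogramDefect x z
    rw [hz, pow_mul] at this
    norm_num at this
    linarith
  refine ⟨fun x y => ?_⟩
  have h1 := hnonneg x y
  have h2 := hnonneg x ((2 : ℝ) • (2 : ℝ) • (2 : ℝ) • y)
  rw [h8] at h2
  have h3 : parallelogramDefect x y = 0 := by linarith
  unfold parallelogramDefect at h3
  linarith

end RealNormed

/-! ### Each condition implies an inner product -/

section Lorch

variable {B : Type u} [NormedAddCommGroup B] [NormedSpace ℂ B]

theorem InnerProductSpaceable.isometricToInnerProductSpace (h : InnerProductSpaceable B) :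
    IsometricToInnerProductSpace B :=
  ⟨B, inferInstance, InnerProductSpace.ofNorm ℂ h.parallelogram_identity,
    ⟨LinearIsometryEquiv.refl ℂ B⟩⟩

theorem IsoscelesImpliesBirkhoff.isometricToInnerProductSpace (h : IsoscelesImpliesBirkhoff B) :
    IsometricToInnerProductSpace B :=
  h.innerProductSpaceable.isometricToInnerProductSpace

theorem LorchI1.isometricToInnerProductSpace (h : LorchI1 B) : IsometricToInnerProductSpace B := by
  obtain ⟨γ, h0, h1, h1', h⟩ := h
  simp only [Complex.coe_smul] at h
  exact (isoscelesImpliesBirkhoff_of_homogeneous h0 h1 h1' h).isometricToInnerProductSpace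

theorem LorchI1'.lorchI1 (h : LorchI1' B) : LorchI1 B := by
  obtain ⟨γ, h0, h1, h1', h⟩ := h
  have hγ : 1 + γ ≠ 0 := fun h => h1' (by linarith)
  -- Applying the hypothesis to `f + g` and `f - g` leaves coefficients `1 + γ` and `±(1 - γ)`.
  refine ⟨(1 - γ) / (1 + γ), div_ne_zero (sub_ne_zero.2 h1.symm) hγ, ?_, ?_, fun f g hfg => ?_⟩
  · intro h
    rw [div_eq_one_iff_eq hγ] at h
    exact h0 (by linarith)
  · intro h
    rw [div_eq_iff hγ] at h
    linarith
  · simp only [Complex.coe_smul] at h ⊢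
    have key := h _ _ hfg
    have e1 : f + g + γ • (f - g) = (1 + γ) • (f + ((1 - γ) / (1 + γ)) • g) := by
      rw [smul_add (1 + γ), smul_smul, mul_div_cancel₀ _ hγ]; module
    have e2 : f - g + γ • (f + g) = (1 + γ) • (f - ((1 - γ) / (1 + γ)) • g) := by
      rw [smul_sub (1 + γ), smul_smul, mul_div_cancel₀ _ hγ]; module
    rw [e1, e2, norm_smul, norm_smul] at key
    exact mul_left_cancel₀ (norm_ne_zero_iff.2 hγ) key

theorem LorchI2.lorchI1' (h : LorchI2 B) : LorchI1' B := by
  refine ⟨2, by norm_num, by norm_num, by norm_num, fun f g hfg => ?_⟩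
  have := h f g (-(f + g)) (by abel) hfg
  simp only [Complex.coe_smul]
  rw [show f + (2 : ℝ) • g = g - -(f + g) by module,
    show g + (2 : ℝ) • f = f - -(f + g) by module, this]

theorem LorchI3.lorchI1 (h : LorchI3 B) : LorchI1 B := by
  refine ⟨1 / 2, by norm_num, by norm_num, by norm_num, fun f g hfg => ?_⟩
  have := (h (f + g) (f - g) (-f) (-f) (by abel) hfg rfl).1
  simp only [Complex.coe_smul]
  rw [show f + g - -f = (2 : ℝ) • (f + (1 / 2 : ℝ) • g) by module,
    show f - g - -f = (2 : ℝ) • (f - (1 / 2 : ℝ) • g) by module, norm_smul, norm_smul] at this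
  exact mul_left_cancel₀ (by norm_num) this

theorem LorchI4.innerProductSpaceable (h : LorchI4 B) : InnerProductSpaceable B := by
  refine ⟨fun x y => ?_⟩
  have := h ((1 / 2 : ℝ) • x) ((1 / 2 : ℝ) • x) y 0
  unfold lorchPhi at this
  rw [show (1 / 2 : ℝ) • x + (1 / 2 : ℝ) • x = x by module] at this
  simp only [sub_self, zero_sub, zero_add, sub_zero, add_zero, norm_neg, norm_zero] at this
  linarith

theorem LorchI5.isometricToInnerProductSpace (h : LorchI5 B) : IsometricToInnerProductSpace B := by
  refine (isoscelesImpliesBirkhoff_of_le_norm_smul_add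
    fun f g hfg α hα => ?_).isometricToInnerProductSpace
  simpa only [Complex.coe_smul] using h f g hfg α hα

theorem LorchI6.innerProductSpaceable {n : ℕ} (hn : 3 ≤ n) (h : LorchI6 B n) :
    InnerProductSpaceable B := by
  obtain ⟨m, rfl⟩ := Nat.exists_eq_add_of_le' hn
  refine innerProductSpaceable_of_three_vectors fun a b c habc => ?_
  -- Each of the `m` padding zeros adds `‖a‖ ^ 2 + ‖b‖ ^ 2 + ‖c‖ ^ 2` to both sides.
  have key := h (Fin.cons a (Fin.cons b (Fin.cons c fun _ : Fin m => 0)))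
    (by simpa [Fin.sum_univ_succ, add_assoc] using habc)
  simp [Fin.sum_univ_succ, Fin.sum_Ioi_succ] at key
  linarith

/-! ### Inner product spaces satisfy each condition -/

variable {H : Type u} [NormedAddCommGroup H] [InnerProductSpace ℝ H]

theorem LinearIsometry.lorchI1' (e : B →ₗᵢ[ℝ] H) : LorchI1' B := by
  refine ⟨2, by norm_num, by norm_num, by norm_num, fun f g hfg => ?_⟩
  simp only [Complex.coe_smul]
  rw [← e.norm_map, ← e.norm_map g] at hfg
  rw [← e.norm_map, ← e.norm_map (g + _), ← sq_eq_sq₀ (norm_nonneg _) (norm_nonneg _)]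
  simp only [map_add, map_smul, norm_add_sq_real, norm_smul, inner_smul_right, hfg,
    real_inner_comm (e f)]

theorem LinearIsometry.lorchI2 (e : B →ₗᵢ[ℝ] H) : LorchI2 B := by
  intro f g h hs hfg
  obtain rfl : h = -(f + g) := eq_neg_of_add_eq_zero_right hs
  rw [← e.norm_map, ← e.norm_map g] at hfg
  rw [← e.norm_map, ← e.norm_map (g - _), ← sq_eq_sq₀ (norm_nonneg _) (norm_nonneg _)]
  simp only [map_sub, map_neg, map_add, norm_sub_sq_real, inner_neg_right, inner_add_right,
    real_inner_self_eq_norm_sq, hfg, real_inner_comm (e f)]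
  ring

theorem LinearIsometry.lorchI3 (e : B →ₗᵢ[ℝ] H) : LorchI3 B := by
  intro f g h k hs hfg hhk
  obtain rfl : k = -(f + g + h) := eq_neg_of_add_eq_zero_right hs
  rw [← e.norm_map, ← e.norm_map g] at hfg
  rw [norm_neg] at hhk
  have hn : ‖e h‖ ^ 2 = ‖e (f + g + h)‖ ^ 2 := by rw [e.norm_map, e.norm_map, hhk]
  have hf2 : ‖e f‖ ^ 2 = ‖e g‖ ^ 2 := by rw [hfg]
  constructor <;>
  · rw [← e.norm_map, ← e.norm_map (_ - -_), ← sq_eq_sq₀ (norm_nonneg _) (norm_nonneg _)]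
    simp only [map_sub, map_neg, map_add, norm_sub_sq_real, norm_add_sq_real, inner_neg_right,
      inner_add_right, inner_add_left, norm_neg, real_inner_self_eq_norm_sq,
      real_inner_comm (e f)] at hn ⊢
    linarith

theorem LinearIsometry.lorchI1 (e : B →ₗᵢ[ℝ] H) : LorchI1 B :=
  (e.lorchI1').lorchI1

theorem LinearIsometry.lorchI4 (e : B →ₗᵢ[ℝ] H) : LorchI4 B := by
  have hphi : ∀ a b c : B, lorchPhi a b c = 2 * ‖e (a + b)‖ ^ 2 - 2 * ‖e (a - b)‖ ^ 2 := by
    intro a b c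
    unfold lorchPhi
    simp only [← e.norm_map]
    simp only [map_sub e _ c, map_add e _ c, norm_sub_sq_real _ (e c), norm_add_sq_real _ (e c)]
    ring
  intro f₁ f₂ g g'
  rw [hphi, hphi]

theorem LinearIsometry.lorchI5 (e : B →ₗᵢ[ℝ] H) : LorchI5 B := by
  intro f g hfg α hα
  simp only [Complex.coe_smul]
  rw [← e.norm_map, ← e.norm_map g] at hfg
  rw [← e.norm_map, ← e.norm_map (α • f + _), ← sq_le_sq₀ (norm_nonneg _) (norm_nonneg _)]
  have hα2 : 2 ≤ α ^ 2 + α⁻¹ ^ 2 := by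
    have := mul_inv_cancel₀ hα
    nlinarith [sq_nonneg (α - α⁻¹)]
  simp only [map_add, map_smul, norm_add_sq_real, norm_smul, inner_smul_right, inner_smul_left,
    hfg, mul_pow, Real.norm_eq_abs, sq_abs, conj_trivial]
  have : α⁻¹ * (α * inner ℝ (e f) (e g)) = inner ℝ (e f) (e g) := inv_mul_cancel_left₀ hα _
  rw [this]
  nlinarith [sq_nonneg ‖e g‖]

theorem LinearIsometry.lorchI6 (e : B →ₗᵢ[ℝ] H) (n : ℕ) : LorchI6 B n := by
  intro f hf
  have h2 := sum_sum_Ioi_eq_half (fun i j => ‖f i - f j‖ ^ 2)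
    (fun i j => by rw [norm_sub_rev]) (by simp)
  -- The double sum is the inner product of `∑ i, e (f i) = 0` with itself.
  have h0 : ∑ i, ∑ j, inner ℝ (e (f i)) (e (f j)) = (0 : ℝ) := by
    simp only [← inner_sum, ← sum_inner, ← map_sum, hf, map_zero, inner_zero_left]
  have h3 : ∑ i, ∑ j, ‖f i - f j‖ ^ 2 = 2 * ((n : ℝ) * ∑ i, ‖f i‖ ^ 2) := by
    have : ∀ i j, ‖f i - f j‖ ^ 2
        = ‖f i‖ ^ 2 - 2 * inner ℝ (e (f i)) (e (f j)) + ‖f j‖ ^ 2 := fun i j => by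
      rw [← e.norm_map, map_sub, norm_sub_sq_real, e.norm_map, e.norm_map]
    simp only [this, Finset.sum_add_distrib, Finset.sum_sub_distrib, ← Finset.mul_sum, h0,
      Finset.sum_const, Finset.card_univ, Fintype.card_fin, nsmul_eq_mul]
    ring
  linarith

end Lorch

theorem IsometricToInnerProductSpace.exists_linearIsometry {B : Type u} [NormedAddCommGroup B]
    [NormedSpace ℂ B] (h : IsometricToInnerProductSpace B) :
    ∃ (H : Type u) (_ : NormedAddCommGroup H) (_ : InnerProductSpace ℝ H),
      Nonempty (B →ₗᵢ[ℝ] H) := by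
  obtain ⟨H, _, _, ⟨e⟩⟩ := h
  exact ⟨H, inferInstance, InnerProductSpace.complexToReal,
    ⟨⟨e.toLinearEquiv.toLinearMap.restrictScalars ℝ, e.norm_map⟩⟩⟩

theorem mainTheorem5 (B : Type u) [NormedAddCommGroup B] [NormedSpace ℂ B] [Nontrivial B] :
    (IsometricToInnerProductSpace B ↔ LorchI1 B) ∧
    (IsometricToInnerProductSpace B ↔ LorchI1' B) ∧
    (IsometricToInnerProductSpace B ↔ LorchI2 B) ∧
    (IsometricToInnerProductSpace B ↔ LorchI3 B) ∧
    (IsometricToInnerProductSpace B ↔ LorchI4 B) ∧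
    (IsometricToInnerProductSpace B ↔ LorchI5 B) ∧
    (∀ n : ℕ, 3 ≤ n → (IsometricToInnerProductSpace B ↔ LorchI6 B n)) := by
  refine ⟨⟨fun h => ?_, fun h => h.isometricToInnerProductSpace⟩,
    ⟨fun h => ?_, fun h => h.lorchI1.isometricToInnerProductSpace⟩,
    ⟨fun h => ?_, fun h => h.lorchI1'.lorchI1.isometricToInnerProductSpace⟩,
    ⟨fun h => ?_, fun h => h.lorchI1.isometricToInnerProductSpace⟩,
    ⟨fun h => ?_, fun h => h.innerProductSpaceable.isometricToInnerProductSpace⟩,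
    ⟨fun h => ?_, fun h => h.isometricToInnerProductSpace⟩,
    fun n hn => ⟨fun h => ?_,
      fun h => (h.innerProductSpaceable hn).isometricToInnerProductSpace⟩⟩ <;>
  obtain ⟨H, _, _, ⟨e⟩⟩ := h.exists_linearIsometry
  exacts [e.lorchI1, e.lorchI1', e.lorchI2, e.lorchI3, e.lorchI4, e.lorchI5, e.lorchI6 n]
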